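/- Consider an electric power system with a finite set $\mathcal E$ of buses, a reference bus $r\in\mathcal E$, a set $\mathcal E^{HP}\subseteq\mathcal E$ of buses hosting heat pumps, inertias $M_i>0$, damping coefficients $D_i$, turbine--governor time constants $T_{g,i}>0$, droop gains $K_i^P>0$, AGC gain $K^I>0$, voltage magnitudes $V_i>0$, symmetric line susceptances $B_{ij}=B_{ji}$ and constant electrical disturbances $P^L=(P^L_i)_{i\in\mathcal E}$. Its state is $(x_\theta,\omega,P^G,g)$, where $x_\theta=(\theta_i-\theta_r)_{i\neq r}$, and its dynamics are $$\dot\theta_i-\dot\theta_r=\omega_i-\omega_r\ (i\ne r),\qquad M_i\dot\omega_i=-D_i\omega_i-P_i+P_i^G-p_i^H,\qquad T_{g,i}\dot P_i^G=-P_i^G+u_i,\qquad \dot g=-\omega_r,$$ $$P_i=\sum_{j}|B_{ij}|V_iV_j\sin(\theta_i-\theta_j)-P_i^L,\qquad u_i=-K_i^P\omega_i+\delta_{ir}K^Ig,$$ where $p_i^H$ is the electric power drawn by the heat pumps at bus $i\in\mathcal E^{HP}$, and $p_i^H=0$ for $i\notin\mathcal E^{HP}$. The input is $u_1:=-p^H=(-p_i^H)_{i\in\mathcal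 E^{HP}}$ and the output is $y_1:=\omega^{HP}=(\omega_i)_{i\in\mathcal E^{HP}}$. Assume that $D_i\ge D_{\min}>0$ for all $i\in\mathcal E$ and that each $$G_i(s)=D_i+\frac{K_i^P}{T_{g,i}s+1}+\delta_{ir}\frac{K^I}{s(T_{g,i}s+1)}$$ is strictly positive real with a margin $\rho_i>0$: $\Re\,G_i(j\nu)\ge\rho_i$ for all real $\nu\neq0$. Then the system is strictly passive from $u_1$ to $y_1$: there is a constant $\rho_e>0$, depending only on $\mathcal E$, $D_{\min}$ and the margins $\rho_i$, such that for every constant $P^L$ there is a continuously differentiable function $V_e$ of the state which along all trajectories, for all inputs, satisfies $$\dot V_e\le y_1^\top u_1-\rho_e\|y_1\|^2,\qquad \|y_1\|^2:=y_1^\top y_1 .$$ Moreover, $V_e$ is a storage function: at the nominal operating condition $P^L=0$ it satisfies $V_e\ge0$ on the whole state space and $V_e(0)=0$; and for every constant $P^L$ it has a local minimum at each equilibrium for $p^H=0$ at which $|\theta_i-\theta_j|<\pi/2$ for all $i,j$ with $B_{ij}\ne0$ (so that $V_e$ minus its value there is nonnegative near that equilibrium). -/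

import Mathlib

open scoped Topology

/-- An electric power system (EPS) with AGC on a finite set `E` of buses. -/
structure PowerSystem (E : Type*) where
  /-- the reference bus, which carries the AGC integrator -/
  r : E
  /-- the buses that host heat pumps; all the other buses host generators only -/
  HP : Finset E
  /-- inertias -/
  M : E → ℝ
  /-- damping coefficients -/
  D : E → ℝ
  /-- turbine-governor time constants -/
  Tg : E → ℝ
  /-- droop gains -/
  KP : E → ℝ
  /-- AGC gain -/
  KI : ℝ
  /-- line susceptances -/
  B : E → E → ℝ
  /-- voltage magnitudes -/
  Vm : E → ℝ
  M_pos : ∀ i, 0 < M i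
  Tg_pos : ∀ i, 0 < Tg i
  KP_pos : ∀ i, 0 < KP i
  KI_pos : 0 < KI
  Vm_pos : ∀ i, 0 < Vm i
  B_symm : ∀ i j, B i j = B j i

namespace PowerSystem

variable {E : Type*} [Fintype E] [DecidableEq E]

/-- The transfer function
`G_i(s) = D_i + K_i^P / (T_i s + 1) + δ_{ir} K^I / (s (T_i s + 1))`. -/
noncomputable def G (S : PowerSystem E) (i : E) (s : ℂ) : ℂ :=
  (S.D i : ℂ) + (S.KP i : ℂ) / ((S.Tg i : ℂ) * s + 1)
    + (if i = S.r then (S.KI : ℂ) / (s * ((S.Tg i : ℂ) * s + 1)) else 0)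

/-- `G_i` is strictly positive real with margin `ρ`: `Re G_i(jω) ≥ ρ` at all frequencies at which
`G_i(jω)` is defined (at the reference bus `G_i` has a pole at `0`). -/
def IsSPRWithMargin (S : PowerSystem E) (i : E) (ρ : ℝ) : Prop :=
  ∀ ω : ℝ, ω ≠ 0 → ρ ≤ (S.G i (Complex.I * (ω : ℂ))).re

/-- The state `(x_θ, ω, P^G, g)`. The vector `x_θ` lists the phase angles of the buses other
than the reference bus, relative to the reference bus. -/
abbrev State (S : PowerSystem E) : Type _ :=
  ({i : E // i ≠ S.r} → ℝ) × (E → ℝ) × (E → ℝ) × ℝ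

/-- The phase angle of bus `i` relative to the reference bus. -/
def angle (S : PowerSystem E) (x : S.State) (i : E) : ℝ :=
  if h : i = S.r then 0 else x.1 ⟨i, h⟩

/-- The frequency deviation `ω_i`. -/
def freq (S : PowerSystem E) (x : S.State) (i : E) : ℝ := x.2.1 i

/-- The controllable generation `P_i^G`. -/
def gen (S : PowerSystem E) (x : S.State) (i : E) : ℝ := x.2.2.1 i

/-- The state `g` of the AGC integrator. -/
def agc (S : PowerSystem E) (x : S.State) : ℝ := x.2.2.2

/-- The net power `P_i = ∑_j |B_ij| V_i V_j sin (θ_i - θ_j) - P_i^L` flowing out of bus `i`. -/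
noncomputable def netPower (S : PowerSystem E) (PL : E → ℝ) (x : S.State) (i : E) : ℝ :=
  ∑ j, |S.B i j| * S.Vm i * S.Vm j * Real.sin (S.angle x i - S.angle x j) - PL i

/-- The control input `u_i = -K_i^P ω_i + δ_{ir} K^I g`. -/
def control (S : PowerSystem E) (x : S.State) (i : E) : ℝ :=
  -S.KP i * S.freq x i + (if i = S.r then S.KI * S.agc x else 0)

/-- The power drawn by the heat pumps at bus `i`, zero at a bus without heat pumps. -/
def hpPower (S : PowerSystem E) (pH : S.HP → ℝ) (i : E) : ℝ :=
  if h : i ∈ S.HP then pH ⟨i, h⟩ else 0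

/-- The right-hand side of the closed-loop equations
`ẋ_θ = R_I ω`, `M_i ω̇_i = -D_i ω_i - P_i + P_i^G - p_i^H`, `T_i Ṗ_i^G = -P_i^G + u_i`,
`ġ = -ω_r`, solved for the derivatives. -/
noncomputable def field (S : PowerSystem E) (PL : E → ℝ) (pH : S.HP → ℝ) (x : S.State) :
    S.State :=
  (fun i => S.freq x i - S.freq x S.r,
   fun i => (-S.D i * S.freq x i - S.netPower PL x i + S.gen x i - S.hpPower pH i) / S.M i,
   fun i => (-S.gen x i + S.control x i) / S.Tg i,
   -S.freq x S.r)

/-- `x` is a trajectory on the time interval `I` with heat pump power `pH` and constant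
disturbance `PL`. -/
def IsTrajectory (S : PowerSystem E) (PL : E → ℝ) (I : Set ℝ) (pH : ℝ → S.HP → ℝ)
    (x : ℝ → S.State) : Prop :=
  ∀ t ∈ I, HasDerivWithinAt x (S.field PL (pH t) (x t)) I t

/-- The input `u₁ = -p^H`. -/
def input (S : PowerSystem E) (pH : S.HP → ℝ) : S.HP → ℝ := -pH

/-- The output `y₁ = ω^HP`. -/
def output (S : PowerSystem E) (x : S.State) : S.HP → ℝ := fun i => S.freq x i

/-- The dissipation inequality `V̇ ≤ y₁ᵀ u₁ - ρ ‖y₁‖²`, with `‖y₁‖² = y₁ᵀ y₁`, along all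
trajectories on all time intervals and for all inputs. -/
def Dissipates (S : PowerSystem E) (PL : E → ℝ) (ρ : ℝ) (V : S.State → ℝ) : Prop :=
  ∀ (I : Set ℝ), I.OrdConnected → I.Nontrivial →
    ∀ (pH : ℝ → S.HP → ℝ) (x : ℝ → S.State), S.IsTrajectory PL I pH x →
      ∀ t ∈ I, ∃ v : ℝ, HasDerivWithinAt (fun τ => V (x τ)) v I t ∧
        v ≤ S.output (x t) ⬝ᵥ S.input (pH t) - ρ * (S.output (x t) ⬝ᵥ S.output (x t))

/-- `x` is an equilibrium for the constant disturbance `PL` and zero heat pump power. -/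
def IsEquilibrium (S : PowerSystem E) (PL : E → ℝ) (x : S.State) : Prop :=
  S.field PL 0 x = 0

/-- The phase angle difference across every line is less than `π / 2`. -/
def IsSecure (S : PowerSystem E) (x : S.State) : Prop :=
  ∀ i j, S.B i j ≠ 0 → |S.angle x i - S.angle x j| < Real.pi / 2

end PowerSystem

/-! Since `K^I/(s(Ts+1)) = K^I/s - T K^I/(Ts+1)`, each `G_i` is a first-order lag `D + κ/(Ts+1)`,
with `κ = lagGain`, plus a lossless integrator at the reference bus. Letting the frequency tend to
`0` in the margin gives `D + κ ≥ ρ`.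

The state of the lag is `q = genDev`. The storage function adds kinetic, line and AGC energy, the
weighted squares `α T q²/2`, and terms linear in `PL` that absorb the disturbance. Lines and
integrator only exchange power, so besides the supply rate its derivative keeps, at each bus, `-D ω²
+ (1 - α κ) ω q - α q²`. With `α = 1 / max κ (D - c)` this is at most `-c ω²` as soon as `c < D` and
`c ≤ D + κ` (`mul_le_of_max_gain`).

Near a secure equilibrium, convexity of `1 - cos` keeps the line potential above its tangent
(`sin_mul_sub_le_cos_sub_cos`); the linear terms cancel and squares remain. -/

/-- `1 - cos` lies above its tangents on the interval `(-π/2, π/2)`, on which it is convex. -/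
theorem sin_mul_sub_le_cos_sub_cos {a b : ℝ} (ha : |a| < Real.pi / 2) (hb : |b| < Real.pi / 2) :
    Real.sin a * (b - a) ≤ Real.cos a - Real.cos b := by
  have ha' : a ∈ Set.Icc (-(Real.pi / 2)) (Real.pi / 2) := abs_le.mp ha.le
  have hb' : b ∈ Set.Icc (-(Real.pi / 2)) (Real.pi / 2) := abs_le.mp hb.le
  rcases lt_trichotomy a b with h | rfl | h
  · have := strictConcaveOn_cos_Icc.concaveOn.slope_le_of_hasDerivAt ha' hb' h
      (Real.hasDerivAt_cos a)
    rw [slope_def_field, div_le_iff₀ (sub_pos.2 h)] at this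
    linarith
  · simp
  · have := strictConcaveOn_cos_Icc.concaveOn.le_slope_of_hasDerivAt hb' ha' h
      (Real.hasDerivAt_cos a)
    rw [slope_def_field, le_div_iff₀ (sub_pos.2 h)] at this
    linarith

/-- A quadratic form `-d ω² + (1 - κ / m) ω q - q² / m` is nonpositive when `m = max κ d` and
`κ ≥ -d`. -/
theorem mul_le_of_max_gain {d κ ω q : ℝ} (hd : 0 < d) (hκ : -d ≤ κ) :
    (1 - κ / max κ d) * (ω * q) ≤ d * ω ^ 2 + q ^ 2 / max κ d := by
  rcases le_total d κ with h | h
  -- With `m = κ` the cross term vanishes.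
  · rw [max_eq_left h, div_self (hd.trans_le h).ne']
    have : 0 < κ := hd.trans_le h
    have : 0 ≤ d * ω ^ 2 + q ^ 2 / κ := by positivity
    linarith
  · rw [max_eq_right h]
    -- Here `|κ| ≤ d`, so all three squares have nonnegative weights.
    have key : d * ω ^ 2 + q ^ 2 / d - (1 - κ / d) * (ω * q)
        = ((d + κ) * (d * ω) ^ 2 + (d + κ) * q ^ 2 + (d - κ) * (d * ω - q) ^ 2) / (2 * d ^ 2) := by
      field_simp
      ring
    have h1 : 0 ≤ d + κ := by linarith
    have h2 : 0 ≤ d - κ := by linarith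
    have : 0 ≤ d * ω ^ 2 + q ^ 2 / d - (1 - κ / d) * (ω * q) := by
      rw [key]; positivity
    linarith

set_option linter.unusedSectionVars false

namespace PowerSystem

variable {E : Type*} [Fintype E] [DecidableEq E]

/-! ### Lag coordinates, line flows and the storage function -/

/-- The generation relative to the set-point given by the AGC. -/
def genDev (S : PowerSystem E) (x : S.State) (i : E) : ℝ :=
  S.gen x i - (if i = S.r then S.KI * S.agc x else 0)

/-- The gain from `-ω_i` to the generation relative to the set-point given by the AGC. -/
def lagGain (S : PowerSystem E) (i : E) : ℝ :=
  S.KP i - (if i = S.r then S.Tg i * S.KI else 0)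

/-- The coupling `|B_ij| V_i V_j` of two buses. -/
def coupling (S : PowerSystem E) (i j : E) : ℝ := |S.B i j| * S.Vm i * S.Vm j

/-- The power flowing from bus `i` into the network. -/
noncomputable def flow (S : PowerSystem E) (x : S.State) (i : E) : ℝ :=
  ∑ j, S.coupling i j * Real.sin (S.angle x i - S.angle x j)

/-- The potential energy stored in the lines. -/
noncomputable def linePotential (S : PowerSystem E) (x : S.State) : ℝ :=
  ∑ i, ∑ j, S.coupling i j / 2 * (1 - Real.cos (S.angle x i - S.angle x j))

/-- The storage function with weights `α` on the generation states. -/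
noncomputable def storage (S : PowerSystem E) (α : E → ℝ) (PL : E → ℝ) (x : S.State) : ℝ :=
  (∑ i, (S.M i / 2 * S.freq x i ^ 2 + α i * S.Tg i / 2 * S.genDev x i ^ 2
      - PL i * S.angle x i))
    + S.KI / 2 * S.agc x ^ 2 + S.linePotential x + (∑ i, PL i) * S.agc x

theorem coupling_comm (S : PowerSystem E) (i j : E) : S.coupling i j = S.coupling j i := by
  unfold coupling
  rw [S.B_symm i j]
  ring

theorem coupling_nonneg (S : PowerSystem E) (i j : E) : 0 ≤ S.coupling i j :=
  mul_nonneg (mul_nonneg (abs_nonneg _) (S.Vm_pos i).le) (S.Vm_pos j).le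

theorem netPower_eq (S : PowerSystem E) (PL : E → ℝ) (x : S.State) (i : E) :
    S.netPower PL x i = S.flow x i - PL i := rfl

@[simp]
theorem angle_ref (S : PowerSystem E) (x : S.State) : S.angle x S.r = 0 := by
  simp [angle]

/-- Pairing the network flows with a vector of angles. -/
theorem sum_flow_mul (S : PowerSystem E) (x : S.State) (w : E → ℝ) :
    ∑ i, S.flow x i * w i = ∑ i, ∑ j, S.coupling i j / 2 *
      (Real.sin (S.angle x i - S.angle x j) * (w i - w j)) := by
  have h1 : ∑ i, S.flow x i * w i
      = ∑ i, ∑ j, S.coupling i j * Real.sin (S.angle x i - S.angle x j) * w i := by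
    simp only [flow, Finset.sum_mul]
  -- Exchange the two buses: the sine is odd and the coupling symmetric. The claim is the average of
  -- both forms.
  have h2 : ∑ i, S.flow x i * w i
      = ∑ i, ∑ j, -(S.coupling i j * Real.sin (S.angle x i - S.angle x j) * w j) := by
    rw [h1, Finset.sum_comm]
    refine Finset.sum_congr rfl fun i _ => Finset.sum_congr rfl fun j _ => ?_
    rw [S.coupling_comm j i, ← neg_sub (S.angle x i), Real.sin_neg]
    ring
  have h3 : ∑ i, S.flow x i * w i
      = (∑ i, S.flow x i * w i + ∑ i, S.flow x i * w i) / 2 := by ring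
  rw [h3]
  nth_rw 1 [h1]
  rw [h2, ← Finset.sum_add_distrib, Finset.sum_div]
  refine Finset.sum_congr rfl fun i _ => ?_
  rw [← Finset.sum_add_distrib, Finset.sum_div]
  exact Finset.sum_congr rfl fun j _ => by ring

theorem sum_flow (S : PowerSystem E) (x : S.State) : ∑ i, S.flow x i = 0 := by
  simpa using S.sum_flow_mul x fun _ => 1

/-! ### Continuous differentiability -/

section Smoothness

theorem contDiff_angle (S : PowerSystem E) (i : E) : ContDiff ℝ 1 fun x => S.angle x i := by
  unfold angle
  split_ifs <;> fun_prop

theorem contDiff_freq (S : PowerSystem E) (i : E) : ContDiff ℝ 1 fun x => S.freq x i := by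
  unfold freq
  fun_prop

theorem contDiff_agc (S : PowerSystem E) : ContDiff ℝ 1 S.agc := by
  unfold agc
  fun_prop

theorem contDiff_genDev (S : PowerSystem E) (i : E) : ContDiff ℝ 1 fun x => S.genDev x i := by
  unfold genDev gen agc
  split_ifs <;> fun_prop

theorem contDiff_storage (S : PowerSystem E) (α PL : E → ℝ) : ContDiff ℝ 1 (S.storage α PL) := by
  have := S.contDiff_angle
  have := S.contDiff_freq
  have := S.contDiff_agc
  have := S.contDiff_genDev
  unfold storage linePotential
  fun_prop

end Smoothness

/-! ### Derivatives along curves -/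

section Trajectory

variable {S : PowerSystem E} {I : Set ℝ} {x : ℝ → S.State} {v : S.State} {t : ℝ}

theorem hasDerivWithinAt_freq (h : HasDerivWithinAt x v I t) (i : E) :
    HasDerivWithinAt (fun τ => S.freq (x τ) i) (S.freq v i) I t :=
  (hasDerivWithinAt_pi.1 (h.hasFDerivWithinAt.snd.fst.hasDerivWithinAt) i).congr_deriv <| by
    simp [freq]

theorem hasDerivWithinAt_gen (h : HasDerivWithinAt x v I t) (i : E) :
    HasDerivWithinAt (fun τ => S.gen (x τ) i) (S.gen v i) I t :=
  (hasDerivWithinAt_pi.1 (h.hasFDerivWithinAt.snd.snd.fst.hasDerivWithinAt) i).congr_deriv <| by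
    simp [gen]

theorem hasDerivWithinAt_agc (h : HasDerivWithinAt x v I t) :
    HasDerivWithinAt (fun τ => S.agc (x τ)) (S.agc v) I t :=
  (h.hasFDerivWithinAt.snd.snd.snd.hasDerivWithinAt).congr_deriv <| by
    simp [agc]

theorem hasDerivWithinAt_angle (h : HasDerivWithinAt x v I t) (i : E) :
    HasDerivWithinAt (fun τ => S.angle (x τ) i) (S.angle v i) I t := by
  unfold angle
  split_ifs with hi
  · exact hasDerivWithinAt_const ..
  · exact (hasDerivWithinAt_pi.1 (h.hasFDerivWithinAt.fst.hasDerivWithinAt) ⟨i, hi⟩).congr_deriv (by simp)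

theorem hasDerivWithinAt_genDev (h : HasDerivWithinAt x v I t) (i : E) :
    HasDerivWithinAt (fun τ => S.genDev (x τ) i) (S.genDev v i) I t := by
  unfold genDev
  split_ifs with hi
  · exact (hasDerivWithinAt_gen h i).sub ((hasDerivWithinAt_agc h).const_mul _)
  · exact (hasDerivWithinAt_gen h i).sub (hasDerivWithinAt_const ..)

theorem hasDerivWithinAt_linePotential (h : HasDerivWithinAt x v I t) :
    HasDerivWithinAt (fun τ => S.linePotential (x τ))
      (∑ i, S.flow (x t) i * S.angle v i) I t := by
  rw [S.sum_flow_mul]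
  refine HasDerivWithinAt.fun_sum fun i _ => HasDerivWithinAt.fun_sum fun j _ => ?_
  have h1 := (((hasDerivWithinAt_angle h i).sub (hasDerivWithinAt_angle h j)).cos.const_sub
    1).const_mul (S.coupling i j / 2)
  refine h1.congr_deriv ?_
  simp only [Pi.sub_apply]
  ring

theorem hasDerivWithinAt_storage (α PL : E → ℝ) (h : HasDerivWithinAt x v I t) :
    HasDerivWithinAt (fun τ => S.storage α PL (x τ))
      ((∑ i, (S.M i * S.freq (x t) i * S.freq v i
          + α i * S.Tg i * S.genDev (x t) i * S.genDev v i - PL i * S.angle v i))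
        + S.KI * S.agc (x t) * S.agc v + ∑ i, S.flow (x t) i * S.angle v i
        + (∑ i, PL i) * S.agc v) I t := by
  have hsum := HasDerivWithinAt.fun_sum (u := Finset.univ) fun i (_ : i ∈ Finset.univ) =>
    ((((hasDerivWithinAt_freq h i).fun_pow 2).const_mul (S.M i / 2)).add
      (((hasDerivWithinAt_genDev h i).fun_pow 2).const_mul (α i * S.Tg i / 2))).sub
      ((hasDerivWithinAt_angle h i).const_mul (PL i))
  refine (((hsum.add (((hasDerivWithinAt_agc h).fun_pow 2).const_mul (S.KI / 2))).add
    (hasDerivWithinAt_linePotential h)).add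
    ((hasDerivWithinAt_agc h).const_mul (∑ i, PL i))).congr_deriv ?_
  congr 2
  congr 1
  · exact Finset.sum_congr rfl fun i _ => by norm_num; ring
  · norm_num; ring

end Trajectory

/-! ### Energy balance along the vector field -/

section Field

variable (S : PowerSystem E) (PL : E → ℝ) (pH : S.HP → ℝ) (x : S.State)

theorem angle_field (i : E) :
    S.angle (S.field PL pH x) i = S.freq x i - S.freq x S.r := by
  unfold angle
  split_ifs with h
  · simp [h]
  · rfl

theorem agc_field : S.agc (S.field PL pH x) = -S.freq x S.r := rfl

theorem M_mul_freq_field (i : E) :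
    S.M i * S.freq (S.field PL pH x) i
      = -S.D i * S.freq x i - S.netPower PL x i + S.gen x i - S.hpPower pH i :=
  mul_div_cancel₀ _ (S.M_pos i).ne'

/-- The moving set-point `K^I g` contributes `T K^I ω_r`, which lowers the droop gain at the
reference bus to `lagGain`. -/
theorem Tg_mul_genDev_field (i : E) :
    S.Tg i * S.genDev (S.field PL pH x) i = -S.genDev x i - S.lagGain i * S.freq x i := by
  have h : S.Tg i * S.gen (S.field PL pH x) i = -S.gen x i + S.control x i :=
    mul_div_cancel₀ _ (S.Tg_pos i).ne'
  unfold genDev lagGain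
  rw [mul_sub, h, agc_field, control]
  split_ifs with hi
  · subst hi; ring
  · ring

/-- The sum over the heat pump buses as a sum over all the buses. -/
theorem sum_freq_mul_hpPower :
    ∑ i, S.freq x i * S.hpPower pH i = S.output x ⬝ᵥ pH := by
  have h : ∀ i, i ∉ S.HP → S.freq x i * S.hpPower pH i = 0 := fun i hi => by
    simp [hpPower, hi]
  rw [← Finset.sum_subset (Finset.subset_univ S.HP) fun i _ hi => h i hi,
    ← Finset.sum_coe_sort S.HP]
  exact Finset.sum_congr rfl fun i _ => by simp [hpPower, output]

theorem output_dotProduct_self_le :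
    S.output x ⬝ᵥ S.output x ≤ ∑ i, S.freq x i ^ 2 := by
  have h : S.output x ⬝ᵥ S.output x = ∑ i ∈ S.HP, S.freq x i ^ 2 := by
    rw [← Finset.sum_coe_sort S.HP]
    exact Finset.sum_congr rfl fun i _ => (sq _).symm
  rw [h]
  exact Finset.sum_le_sum_of_subset_of_nonneg (Finset.subset_univ _) fun i _ _ => sq_nonneg _

/-- The derivative of the storage function along the vector field. -/
theorem storage_deriv_field (α : E → ℝ) :
    (∑ i, (S.M i * S.freq x i * S.freq (S.field PL pH x) i
        + α i * S.Tg i * S.genDev x i * S.genDev (S.field PL pH x) i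
        - PL i * S.angle (S.field PL pH x) i))
      + S.KI * S.agc x * S.agc (S.field PL pH x)
      + ∑ i, S.flow x i * S.angle (S.field PL pH x) i
      + (∑ i, PL i) * S.agc (S.field PL pH x)
    = (∑ i, (-S.D i * S.freq x i ^ 2
        + (1 - α i * S.lagGain i) * (S.freq x i * S.genDev x i)
        - α i * S.genDev x i ^ 2)) - S.output x ⬝ᵥ pH := by
  -- Written as a sum over buses, the AGC energy rate cancels the set-point part of `gen`.
  have hagc : S.KI * S.agc x * S.freq x S.r
      = ∑ i, S.freq x i * (if i = S.r then S.KI * S.agc x else 0) := by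
    simp [mul_comm]
  -- The reference frequency drops out because the flows sum to zero.
  have hflow : ∑ i, S.flow x i * S.angle (S.field PL pH x) i
      = ∑ i, S.flow x i * S.freq x i := by
    simp only [angle_field, mul_sub, Finset.sum_sub_distrib, ← Finset.sum_mul, sum_flow]
    ring
  rw [hflow, agc_field, mul_neg, mul_neg, hagc, ← sum_freq_mul_hpPower, Finset.sum_mul,
    ← sub_eq_add_neg, ← sub_eq_add_neg, ← Finset.sum_sub_distrib, ← Finset.sum_add_distrib,
    ← Finset.sum_sub_distrib, ← Finset.sum_sub_distrib]
  refine Finset.sum_congr rfl fun i _ => ?_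
  have h1 := S.M_mul_freq_field PL pH x i
  have h2 := S.Tg_mul_genDev_field PL pH x i
  have h3 : S.gen x i = S.genDev x i + (if i = S.r then S.KI * S.agc x else 0) := by
    simp [genDev]
  rw [netPower_eq, h3] at h1
  rw [angle_field]
  linear_combination S.freq x i * h1 + α i * S.genDev x i * h2

end Field

/-! ### Choice of weights, dissipation and nonnegativity -/

/-- The weight of the generation state of bus `i` in the storage function with dissipation
rate `c`. -/
noncomputable def lagWeight (S : PowerSystem E) (c : ℝ) (i : E) : ℝ :=
  (max (S.lagGain i) (S.D i - c))⁻¹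

theorem lagWeight_nonneg (S : PowerSystem E) {c : ℝ} {i : E} (h : c < S.D i) :
    0 ≤ S.lagWeight c i :=
  inv_nonneg.2 (le_max_of_le_right (sub_pos.2 h).le)

theorem dissipates_storage (S : PowerSystem E) (PL : E → ℝ) {c : ℝ} (hc : 0 ≤ c)
    (hD : ∀ i, c < S.D i) (hgain : ∀ i, c ≤ S.D i + S.lagGain i) :
    S.Dissipates PL c (S.storage (S.lagWeight c) PL) := by
  intro I _ _ pH x hx t ht
  refine ⟨_, hasDerivWithinAt_storage _ PL (hx t ht), ?_⟩
  rw [storage_deriv_field]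
  have hle : ∑ i, (-S.D i * S.freq (x t) i ^ 2
        + (1 - S.lagWeight c i * S.lagGain i) * (S.freq (x t) i * S.genDev (x t) i)
        - S.lagWeight c i * S.genDev (x t) i ^ 2) ≤ ∑ i, -c * S.freq (x t) i ^ 2 := by
    refine Finset.sum_le_sum fun i _ => ?_
    -- Taking `d = D_i - c` reserves `c ω_i²` of the damping for the dissipation rate.
    have := mul_le_of_max_gain (ω := S.freq (x t) i) (q := S.genDev (x t) i)
      (sub_pos.2 (hD i)) (by linarith [hgain i] : -(S.D i - c) ≤ S.lagGain i)
    rw [div_eq_inv_mul, div_eq_inv_mul] at this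
    change (1 - S.lagWeight c i * S.lagGain i) * _ ≤ _ + S.lagWeight c i * _ at this
    linarith
  have hout := mul_le_mul_of_nonneg_left (S.output_dotProduct_self_le (x t)) hc
  rw [← Finset.mul_sum] at hle
  rw [input, dotProduct_neg]
  linarith

theorem linePotential_nonneg (S : PowerSystem E) (x : S.State) : 0 ≤ S.linePotential x :=
  Finset.sum_nonneg fun i _ => Finset.sum_nonneg fun j _ =>
    mul_nonneg (div_nonneg (S.coupling_nonneg i j) zero_le_two)
      (sub_nonneg.2 (Real.cos_le_one _))

theorem storage_nonneg (S : PowerSystem E) {α : E → ℝ} (hα : ∀ i, 0 ≤ α i) (x : S.State) :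
    0 ≤ S.storage α 0 x := by
  have h1 := S.linePotential_nonneg x
  have h2 := S.KI_pos
  have h3 : 0 ≤ ∑ i, (S.M i / 2 * S.freq x i ^ 2 + α i * S.Tg i / 2 * S.genDev x i ^ 2) :=
    Finset.sum_nonneg fun i _ => by
      have := S.M_pos i
      have := S.Tg_pos i
      have := hα i
      positivity
  simp only [storage, Pi.zero_apply, zero_mul, sub_zero, Finset.sum_const_zero, add_zero]
  positivity

theorem storage_zero (S : PowerSystem E) (α : E → ℝ) : S.storage α 0 0 = 0 := by
  have hangle : ∀ i, S.angle 0 i = 0 := fun i => by unfold angle; split_ifs <;> rfl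
  simp [storage, linePotential, genDev, freq, gen, agc, hangle]

/-! ### Local minimum at secure equilibria -/

section Equilibrium

variable {S : PowerSystem E} {PL : E → ℝ} {x : S.State}

theorem IsEquilibrium.freq_eq_zero (h : S.IsEquilibrium PL x) (i : E) : S.freq x i = 0 := by
  have h0 : S.field PL 0 x = 0 := h
  have hr : S.freq x S.r = 0 := by
    have := S.agc_field PL 0 x
    rw [h0] at this
    exact neg_eq_zero.1 this.symm
  have := S.angle_field PL 0 x i
  rw [h0, hr, sub_zero] at this
  rw [← this]
  unfold angle
  split_ifs <;> rfl

theorem IsEquilibrium.genDev_eq_zero (h : S.IsEquilibrium PL x) (i : E) : S.genDev x i = 0 := by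
  have h0 : S.field PL 0 x = 0 := h
  have := S.Tg_mul_genDev_field PL 0 x i
  rw [h0, h.freq_eq_zero] at this
  have hzero : S.genDev 0 i = 0 := by simp [genDev, gen, agc]
  rw [hzero] at this
  linarith

theorem IsEquilibrium.flow_eq (h : S.IsEquilibrium PL x) (i : E) :
    S.flow x i = PL i + (if i = S.r then S.KI * S.agc x else 0) := by
  have h0 : S.field PL 0 x = 0 := h
  have h1 := S.M_mul_freq_field PL 0 x i
  have h2 := h.genDev_eq_zero i
  have h3 : S.freq 0 i = 0 := rfl
  have h4 : S.hpPower 0 i = 0 := by simp [hpPower]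
  rw [h0, h.freq_eq_zero, netPower_eq, h3, h4] at h1
  unfold genDev at h2
  linarith

theorem IsEquilibrium.sum_add_agc_eq_zero (h : S.IsEquilibrium PL x) :
    ∑ i, PL i + S.KI * S.agc x = 0 := by
  have := S.sum_flow x
  simpa [h.flow_eq, Finset.sum_add_distrib] using this

theorem IsEquilibrium.sum_flow_mul_angle (h : S.IsEquilibrium PL x) (y : S.State) :
    ∑ i, S.flow x i * (S.angle y i - S.angle x i)
      = ∑ i, PL i * S.angle y i - ∑ i, PL i * S.angle x i := by
  rw [← Finset.sum_sub_distrib]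
  refine Finset.sum_congr rfl fun i _ => ?_
  rw [h.flow_eq]
  -- The AGC power enters only at the reference bus, where the angle is zero.
  split_ifs with hi
  · subst hi; simp
  · ring

/-- Near a secure state the line potential lies above its tangent hyperplane. -/
theorem IsSecure.eventually_le_linePotential (hs : S.IsSecure x) :
    ∀ᶠ y in 𝓝 x, S.linePotential x + ∑ i, S.flow x i * (S.angle y i - S.angle x i)
      ≤ S.linePotential y := by
  have hnear : ∀ᶠ y in 𝓝 x, ∀ i j, S.B i j ≠ 0 →
      |S.angle y i - S.angle y j| < Real.pi / 2 := by
    refine Filter.eventually_all.2 fun i => Filter.eventually_all.2 fun j => ?_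
    by_cases hB : S.B i j = 0
    · simp [hB]
    · have hcont : Continuous fun y => |S.angle y i - S.angle y j| :=
        ((S.contDiff_angle i).continuous.sub (S.contDiff_angle j).continuous).abs
      filter_upwards [hcont.continuousAt.eventually_lt continuousAt_const (hs i j hB)]
        with y hy _ using hy
  filter_upwards [hnear] with y hy
  rw [S.sum_flow_mul]
  simp only [linePotential, ← Finset.sum_add_distrib]
  refine Finset.sum_le_sum fun i _ => Finset.sum_le_sum fun j _ => ?_
  by_cases hB : S.B i j = 0
  · simp [coupling, hB]
  · rw [← mul_add]
    refine mul_le_mul_of_nonneg_left ?_ (div_nonneg (S.coupling_nonneg i j) zero_le_two)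
    have := sin_mul_sub_le_cos_sub_cos (hs i j hB) (hy i j hB)
    linarith

theorem IsEquilibrium.isLocalMin_storage (h : S.IsEquilibrium PL x) (hs : S.IsSecure x)
    {α : E → ℝ} (hα : ∀ i, 0 ≤ α i) : IsLocalMin (S.storage α PL) x := by
  filter_upwards [hs.eventually_le_linePotential] with y hy
  rw [h.sum_flow_mul_angle] at hy
  have hquad : 0 ≤ ∑ i, (S.M i / 2 * S.freq y i ^ 2 + α i * S.Tg i / 2 * S.genDev y i ^ 2) :=
    Finset.sum_nonneg fun i _ => by
      have := S.M_pos i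
      have := S.Tg_pos i
      have := hα i
      positivity
  -- By `hPL` below, the quadratic and linear terms in `g` complete to this square.
  have hagc : 0 ≤ S.KI / 2 * (S.agc y - S.agc x) ^ 2 :=
    mul_nonneg (half_pos S.KI_pos).le (sq_nonneg _)
  have hPL : ∑ i, PL i = -(S.KI * S.agc x) := eq_neg_of_add_eq_zero_left h.sum_add_agc_eq_zero
  simp only [storage, h.freq_eq_zero, h.genDev_eq_zero, hPL, Finset.sum_sub_distrib]
  norm_num
  linarith

end Equilibrium

/-! ### Frequency-domain margin and conclusion -/

/-- The real part of the transfer function on the imaginary axis. -/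
theorem re_G (S : PowerSystem E) (i : E) {ν : ℝ} (hν : ν ≠ 0) :
    (S.G i (Complex.I * (ν : ℂ))).re = S.D i + S.lagGain i / (1 + (S.Tg i * ν) ^ 2) := by
  have hpos : 0 < 1 + (S.Tg i * ν) ^ 2 := by positivity
  have hT := S.Tg_pos i
  have hν2 : 0 < ν ^ 2 := by positivity
  unfold G lagGain
  split_ifs with h
  · simp [Complex.div_re, Complex.normSq_apply]
    have h1 : S.Tg i * ν * (S.Tg i * ν) + 1 ≠ 0 := by nlinarith
    have h2 : 1 + S.Tg i * ν * (S.Tg i * ν) ≠ 0 := by nlinarith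
    have h3 : ν * (S.Tg i * ν) * (ν * (S.Tg i * ν)) + ν * ν ≠ 0 := by
      have : 0 ≤ (ν * (S.Tg i * ν)) ^ 2 := sq_nonneg _
      nlinarith
    field_simp
    ring
  · simp [Complex.div_re, Complex.normSq_apply]
    ring

/-- A positive real margin bounds the transfer function in the low-frequency limit. -/
theorem IsSPRWithMargin.le_D_add_lagGain {S : PowerSystem E} {i : E} {c : ℝ}
    (h : S.IsSPRWithMargin i c) : c ≤ S.D i + S.lagGain i := by
  have hcont : Continuous fun ν : ℝ => S.D i + S.lagGain i / (1 + (S.Tg i * ν) ^ 2) :=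
    continuous_const.add (continuous_const.div (by fun_prop) fun ν => by positivity)
  -- The limit is taken over `ν ≠ 0`, where the margin is assumed.
  have hlim := (hcont.tendsto 0).mono_left (nhdsWithin_le_nhds (s := {0}ᶜ))
  have := ge_of_tendsto hlim (Filter.eventually_of_mem self_mem_nhdsWithin
    fun ν hν => (h ν hν).trans_eq (S.re_G i hν))
  simpa using this

end PowerSystem

theorem lemma2 {E : Type*} [Fintype E] [DecidableEq E]
    (Dmin : ℝ) (hDmin : 0 < Dmin) (ρ : E → ℝ) (hρ : ∀ i, 0 < ρ i) :
    ∃ ρe : ℝ, 0 < ρe ∧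
      ∀ S : PowerSystem E, (∀ i, Dmin ≤ S.D i) → (∀ i, S.IsSPRWithMargin i (ρ i)) →
        ∀ PL : E → ℝ, ∃ V : S.State → ℝ,
          ContDiff ℝ 1 V ∧
          S.Dissipates PL ρe V ∧
          (PL = 0 → V 0 = 0 ∧ ∀ x, 0 ≤ V x) ∧
          (∀ x, S.IsEquilibrium PL x → S.IsSecure x → IsLocalMin V x) := by
  -- The rate is fixed before the system, so an empty `E` needs a default value.
  obtain ⟨c, hc, hcρ⟩ : ∃ c : ℝ, 0 < c ∧ ∀ i, c ≤ ρ i := by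
    cases isEmpty_or_nonempty E
    · exact ⟨1, one_pos, isEmptyElim⟩
    · obtain ⟨i, hi⟩ := Finite.exists_min ρ
      exact ⟨ρ i, hρ i, hi⟩
  have hpos : 0 < min Dmin c := lt_min hDmin hc
  -- Halving gives `ρe < D_i` strictly, which keeps `max κ (D_i - ρe)` positive.
  refine ⟨min Dmin c / 2, half_pos hpos, fun S hD hG PL => ?_⟩
  have hDlt : ∀ i, min Dmin c / 2 < S.D i := fun i =>
    (half_lt_self hpos).trans_le ((min_le_left _ _).trans (hD i))
  have hα : ∀ i, 0 ≤ S.lagWeight (min Dmin c / 2) i := fun i => S.lagWeight_nonneg (hDlt i)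
  refine ⟨S.storage (S.lagWeight (min Dmin c / 2)) PL, S.contDiff_storage _ _,
    S.dissipates_storage PL (half_pos hpos).le hDlt fun i => ?_, ?_,
    fun x hx hs => hx.isLocalMin_storage hs hα⟩
  · exact (half_le_self hpos.le).trans
      ((min_le_right _ _).trans ((hcρ i).trans (hG i).le_D_add_lagGain))
  · rintro rfl
    exact ⟨S.storage_zero _, S.storage_nonneg hα⟩
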